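/- For every integer $p\ge 1$ put \[ R_p=\frac{(-1)^{p-1}}{2p\cdot 8^p}\Bigl\{1+\sum_{k=1}^{p}\binom{p}{k}(-4)^k B_{2k}\bigl(\tfrac12\bigr)\Bigr\}, \] where $B_{2k}(x)$ is the Bernoulli polynomial of order $2k$. Let $n$ be a positive integer, put $m=\frac{n(n+1)}{2}$, and let $\gamma$ be Euler's constant. Then for every integer $r\ge 1$ there is a real number $\Theta_r$ (depending on $r$ and $n$) with $0<\Theta_r<1$ such that \[ 1+\frac12+\frac13+\cdots+\frac1n=\frac12\ln(2m)+\gamma+\sum_{p=1}^{r}\frac{R_p}{m^p}+\Theta_r\cdot\frac{R_{r+1}}{m^{r+1}}. \] Moreover, the error is less in absolute value than the first omitted term: \[ \Bigl|1+\frac12+\cdots+\frac1n-\frac12\ln(2m)-\gamma-\sum_{p=1}^{r}\frac{R_p}{m^p}\Bigr|<\Bigl|\frac{R_{r+1}}{m^{r+1}}\Bigr|. \] -/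

import Mathlib

/-- The coefficient
`R_p = (-1)^(p-1) / (2 p 8^p) * (1 + ∑_{k=1}^p C(p,k) (-4)^k B_{2k}(1/2))`, for `p ≥ 1`,
where `B_j(x)` is the `j`-th Bernoulli polynomial. (The value at `p = 0` is irrelevant.) -/
noncomputable def ramanujanCoeff (p : ℕ) : ℝ :=
  (-1 : ℝ) ^ (p - 1) / (2 * (p : ℝ) * 8 ^ p) *
    (1 + ∑ k ∈ Finset.Icc 1 p, (p.choose k : ℝ) * (-4) ^ k * bernoulliFun (2 * k) (1 / 2))

/-!
Put `M = 2m = n(n+1)` and `N = n + 1/2`, so that `N² = M + 1/4`. The proof exhibits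
`H_n - γ - ½ log M` as a Stieltjes transform in `M` of a positive measure on `(0, ∞)`, whose
asymptotic expansion is automatically enveloping.

* Binet-type formula: `H_n = log N + γ + ∫₀^∞ 2t / ((e^{2πt} + 1)(t² + N²)) dt`
  (`harmonic_eq_log_add_binetIntegral`). The integral is rewritten as the Laplace transform of
  `x ↦ 1/x - 1/(2 sinh(x/2))` (`binetIntegral_eq_laplace`), the kernel being obtained from the
  partial fractions of the cotangent. Its increment from `N` to `N + 1` is then a Frullani integral
  minus an exponential integral, namely `log((N+1)/N) - 1/(N + 1/2)`; as it vanishes at infinity,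
  the formula follows by telescoping.
* Change of variable: the substitution `s = t² + 1/4` turns `t² + N²` into `M + s`, while
  `½ log(N²/M) = ½ ∫₀^{1/4} ds/(M + s)`. Hence
  `H_n - γ - ½ log M = ∫ dμ(s)/(M + s)` for the positive measure `harmonicMeasure`
  (`harmonic_eq_log_add_integral_harmonicMeasure`).
* Moments: `(-1)^(p-1) ∫ s^(p-1) dμ = 2^p R_p` (`integral_pow_harmonicMeasure`), because
  `∫₀^∞ t^(2k-1)/(e^{2πt} + 1) dt = (-1)^k B_{2k}(1/2)/(4k)`.
* Enveloping: expanding `1/(M + s)` as a finite geometric sum leaves a remainder with the sign of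
  the first omitted term and strictly smaller in absolute value (`exists_theta_stieltjes`).
-/

open MeasureTheory Set Filter Topology

/-! ### Integrals against `1 / (exp (2πt) + 1)` -/

theorem integral_pow_mul_exp_neg (a : ℕ) {b : ℝ} (hb : 0 < b) :
    ∫ t in Ioi (0 : ℝ), t ^ a * Real.exp (-(b * t)) = a.factorial / b ^ (a + 1) := by
  have h := Real.integral_rpow_mul_exp_neg_mul_Ioi (a := (a : ℝ) + 1) (r := b) (by positivity) hb
  rw [Real.Gamma_nat_eq_factorial] at h
  simp only [add_sub_cancel_right, Real.rpow_natCast] at h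
  rw [h]
  have : ((a : ℝ) + 1) = ((a + 1 : ℕ) : ℝ) := by push_cast; ring
  rw [this, Real.rpow_natCast, one_div, inv_pow]
  ring

theorem integrableOn_pow_mul_exp_neg (a : ℕ) {b : ℝ} (hb : 0 < b) :
    IntegrableOn (fun t : ℝ ↦ t ^ a * Real.exp (-(b * t))) (Ioi 0) := by
  refine Integrable.of_integral_ne_zero ?_
  rw [integral_pow_mul_exp_neg a hb]
  positivity

theorem integral_sin_mul_exp_neg (x : ℝ) {b : ℝ} (hb : 0 < b) :
    ∫ t in Ioi (0 : ℝ), Real.sin (x * t) * Real.exp (-(b * t)) = x / (x ^ 2 + b ^ 2) := by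
  have ha : (-(b : ℂ) + x * Complex.I).re < 0 := by simpa using hb
  have h := integral_exp_mul_complex_Ioi ha 0
  have hi := integrableOn_exp_mul_complex_Ioi ha 0
  have h2 := integral_im (𝕜 := ℂ) hi
  have h3 : ∀ t : ℝ, RCLike.im (Complex.exp ((-(b : ℂ) + x * Complex.I) * t)) =
      Real.sin (x * t) * Real.exp (-(b * t)) := by
    intro t
    rw [RCLike.im_eq_complex_im, Complex.exp_im]
    simp [mul_comm]
  simp only [h3] at h2
  rw [h2, h, RCLike.im_eq_complex_im]
  have hne : x ^ 2 + b ^ 2 ≠ 0 := by positivity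
  simp [Complex.div_im, Complex.normSq_apply]
  field_simp
  ring

theorem hasSum_alternating_exp {t : ℝ} (ht : 0 < t) :
    HasSum (fun j : ℕ ↦ (-1 : ℝ) ^ j * Real.exp (-(2 * Real.pi * (j + 1) * t)))
      (1 / (Real.exp (2 * Real.pi * t) + 1)) := by
  have hq : Real.exp (-(2 * Real.pi * t)) < 1 := by
    rw [Real.exp_lt_one_iff]; have := Real.pi_pos; have : 0 < 2 * Real.pi * t := by positivity
    linarith
  have h := (hasSum_geometric_of_norm_lt_one (ξ := -Real.exp (-(2 * Real.pi * t)))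
    (by simpa using hq)).mul_left (Real.exp (-(2 * Real.pi * t)))
  convert! h using 1
  · funext j
    rw [neg_pow (Real.exp _), ← Real.exp_nat_mul, mul_left_comm, ← Real.exp_add]
    congr 2; ring
  · rw [Real.exp_neg]
    have := Real.exp_pos (2 * Real.pi * t)
    rw [sub_neg_eq_add]
    field_simp

/-- Termwise integration of the geometric expansion of `1 / (exp (2πt) + 1)`. The vanishing of `f`
to order at least one at `0` makes the series of integrals of norms converge. -/
theorem hasSum_integral_div_exp_add_one {f : ℝ → ℝ} (hf : Continuous f) {a : ℕ} (ha : 1 ≤ a)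
    {C : ℝ} (hC : ∀ t, 0 < t → |f t| ≤ C * t ^ a) :
    HasSum (fun j : ℕ ↦ (-1 : ℝ) ^ j *
        ∫ t in Ioi (0 : ℝ), f t * Real.exp (-(2 * Real.pi * (j + 1) * t)))
      (∫ t in Ioi (0 : ℝ), f t / (Real.exp (2 * Real.pi * t) + 1)) := by
  have hb (j : ℕ) : 0 < 2 * Real.pi * ((j : ℝ) + 1) := by positivity
  have hbound (j : ℕ) (t : ℝ) (ht : 0 < t) :
      ‖(-1 : ℝ) ^ j * (f t * Real.exp (-(2 * Real.pi * (j + 1) * t)))‖ ≤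
        C * (t ^ a * Real.exp (-(2 * Real.pi * (j + 1) * t))) := by
    rw [norm_mul, norm_pow, norm_neg, norm_one, one_pow, one_mul, norm_mul, Real.norm_eq_abs,
      Real.norm_eq_abs, Real.abs_exp, ← mul_assoc]
    exact mul_le_mul_of_nonneg_right (hC t ht) (Real.exp_pos _).le
  have hint (j : ℕ) : IntegrableOn
      (fun t ↦ (-1 : ℝ) ^ j * (f t * Real.exp (-(2 * Real.pi * (j + 1) * t)))) (Ioi 0) := by
    refine Integrable.mono' ((integrableOn_pow_mul_exp_neg a (hb j)).const_mul C)
      (by fun_prop) ?_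
    filter_upwards [ae_restrict_mem measurableSet_Ioi] with t ht using hbound j t ht
  have hsum : Summable fun j : ℕ ↦ ∫ t in Ioi (0 : ℝ),
      ‖(-1 : ℝ) ^ j * (f t * Real.exp (-(2 * Real.pi * (j + 1) * t)))‖ := by
    have hs : Summable fun j : ℕ ↦
        C * a.factorial / (2 * Real.pi) ^ (a + 1) * (1 / ((j : ℝ) + 1) ^ (a + 1)) := by
      refine Summable.mul_left _ ?_
      have := (summable_nat_add_iff 1).mpr
        (Real.summable_one_div_nat_pow.mpr (show 1 < a + 1 by omega))
      simpa using this
    refine Summable.of_nonneg_of_le (fun j ↦ integral_nonneg fun t ↦ norm_nonneg _) (fun j ↦ ?_) hs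
    calc _ ≤ ∫ t in Ioi (0 : ℝ), C * (t ^ a * Real.exp (-(2 * Real.pi * (j + 1) * t))) :=
          setIntegral_mono_on (hint j).norm ((integrableOn_pow_mul_exp_neg a (hb j)).const_mul C)
            measurableSet_Ioi fun t ht ↦ hbound j t ht
      _ = _ := by
          rw [integral_const_mul, integral_pow_mul_exp_neg a (hb j), mul_pow]
          field_simp
  have h := hasSum_integral_of_summable_integral_norm hint hsum
  simp only [integral_const_mul] at h
  convert! h using 1
  refine setIntegral_congr_fun measurableSet_Ioi fun t ht ↦ ?_
  have h1 := (hasSum_alternating_exp (mem_Ioi.mp ht)).mul_left (f t)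
  simp only [mul_left_comm] at h1 ⊢
  rw [h1.tsum_eq]
  ring

/-- The odd moments of `1 / (exp (2πt) + 1)`. The alternating series they produce is the Fourier
series of `B_{2k}` evaluated at the midpoint `1/2`. -/
theorem integral_pow_div_exp_add_one {k : ℕ} (hk : 1 ≤ k) :
    ∫ t in Ioi (0 : ℝ), t ^ (2 * k - 1) / (Real.exp (2 * Real.pi * t) + 1) =
      (-1) ^ k * bernoulliFun (2 * k) (1 / 2) / (4 * k) := by
  have h1 := hasSum_integral_div_exp_add_one (f := fun t ↦ t ^ (2 * k - 1)) (by fun_prop)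
    (a := 2 * k - 1) (by omega) (C := 1)
    (fun t ht ↦ by rw [one_mul, abs_of_pos (pow_pos ht _)])
  have h2 := hasSum_one_div_nat_pow_mul_cos (k := k) (x := 1 / 2) (by omega) (by norm_num)
  -- The term at index `0` is zero by the convention `1 / 0 = 0`.
  rw [← hasSum_nat_add_iff' 1] at h2
  have hk2 : 2 * k - 1 + 1 = 2 * k := by omega
  have h3 := h2.mul_left (-((2 * k - 1).factorial / (2 * Real.pi) ^ (2 * k)))
  refine (h1.unique ?_)
  convert! h3 using 1
  · funext j
    rw [integral_pow_mul_exp_neg _ (by positivity), hk2]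
    have : Real.cos (2 * Real.pi * ((j + 1 : ℕ) : ℝ) * (1 / 2)) = (-1) ^ (j + 1) := by
      rw [← Real.cos_nat_mul_pi]; congr 1; ring
    rw [this, pow_succ, mul_pow]
    push_cast
    field_simp
  · have hf : ((2 * k).factorial : ℝ) = 2 * k * (2 * k - 1).factorial := by
      rw [← Nat.mul_factorial_pred (by omega : 2 * k ≠ 0)]; push_cast; ring
    have : ((0 : ℕ) : ℝ) ^ (2 * k) = 0 := by rw [Nat.cast_zero, zero_pow (by omega)]
    simp only [Finset.range_one, Finset.sum_singleton, this, div_zero, zero_mul, sub_zero]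
    rw [hf]
    change _ = _ * (_ * bernoulliFun (2 * k) (1 / 2))
    have hk0 : (k : ℝ) ≠ 0 := by positivity
    rw [pow_succ]
    field_simp
    ring

/-! ### Partial fractions of the hyperbolic kernel -/

/-- The partial fraction expansion of `½ coth (x/2) - 1/x`, written with `exp (-x)`: that of
`π cot (πz)` at `z = ix / 2π`. -/
theorem hasSum_coth {x : ℝ} (hx : 0 < x) :
    HasSum (fun j : ℕ ↦ 2 * x / (x ^ 2 + (2 * Real.pi * (j + 1)) ^ 2))
      ((1 + Real.exp (-x)) / (2 * (1 - Real.exp (-x))) - 1 / x) := by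
  have hpi := Real.pi_pos
  set z : ℂ := (x / (2 * Real.pi) : ℝ) * Complex.I with hz_def
  have hz : z ∈ Complex.integerComplement := by
    rintro ⟨n, hn⟩
    have h := congrArg Complex.im hn
    have : x / (2 * Real.pi) = 0 := by
      rw [hz_def, Complex.im_ofReal_mul, Complex.I_im, mul_one, Complex.intCast_im] at h
      exact h.symm
    have h' : 0 < x / (2 * Real.pi) := by positivity
    exact h'.ne' this
  have h := ((summable_cotTerm hz).hasSum).mul_left (Complex.I / (2 * Real.pi))
  have h2 := cot_series_rep' hz
  change _ = ∑' n, cotTerm z n at h2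
  rw [← h2, Complex.cot_pi_eq_exp_ratio] at h
  rw [← Complex.hasSum_ofReal]
  have he : 2 * Real.pi * Complex.I * z = ((-x : ℝ) : ℂ) := by
    have : (Real.pi : ℂ) ≠ 0 := by exact_mod_cast hpi.ne'
    rw [hz_def]; push_cast
    field_simp
    rw [Complex.I_sq]; ring
  have hpi' : (Real.pi : ℂ) ≠ 0 := by exact_mod_cast hpi.ne'
  have hx' : (x : ℂ) ≠ 0 := by exact_mod_cast hx.ne'
  have hI := Complex.I_sq
  convert! h using 1
  · funext j
    rw [cotTerm_identity hz]
    have h1 : (z + (j + 1)) * (z - (j + 1)) =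
        -(((x ^ 2 + (2 * Real.pi * (j + 1)) ^ 2) / (2 * Real.pi) ^ 2 : ℝ) : ℂ) := by
      rw [hz_def]; push_cast; field_simp; linear_combination (x : ℂ) ^ 2 * hI
    have h3 : ((x ^ 2 + (2 * Real.pi * (j + 1)) ^ 2 : ℝ) : ℂ) ≠ 0 := by
      have : 0 < x ^ 2 + (2 * Real.pi * (j + 1)) ^ 2 := by positivity
      exact_mod_cast this.ne'
    rw [h1, hz_def]
    push_cast at h3 ⊢
    field_simp
    rw [hI]; ring
  · rw [he, hz_def, ← Complex.ofReal_exp]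
    have h3 : ((1 - Real.exp (-x) : ℝ) : ℂ) ≠ 0 := by
      have : Real.exp (-x) < 1 := by rw [Real.exp_lt_one_iff]; linarith
      exact_mod_cast (sub_pos.mpr this).ne'
    push_cast at h3 ⊢
    generalize Complex.exp (-(x : ℂ)) = e at h3 ⊢
    field_simp
    ring

theorem HasSum.alternating_of_odd {a : ℕ → ℝ} {A B : ℝ} (h : HasSum a A)
    (hodd : HasSum (fun k ↦ a (2 * k + 1)) B) :
    HasSum (fun j ↦ (-1 : ℝ) ^ j * a j) (A - 2 * B) := by
  have hev : HasSum (fun k ↦ a (2 * k)) (∑' k, a (2 * k)) :=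
    (h.summable.comp_injective (mul_right_injective₀ (two_ne_zero : (2 : ℕ) ≠ 0))).hasSum
  have hE : ∑' k, a (2 * k) + B = A := (hev.even_add_odd hodd).unique h
  have hA : A - 2 * B = ∑' k, a (2 * k) + -B := by linarith
  rw [hA]
  exact HasSum.even_add_odd (by simpa [pow_mul] using hev)
    (by simpa [pow_succ, pow_mul] using hodd.neg)

/-- The partial fraction expansion of `1/x - 1 / (2 sinh (x/2))`. -/
theorem hasSum_csch {x : ℝ} (hx : 0 < x) :
    HasSum (fun j : ℕ ↦ (-1 : ℝ) ^ j * (2 * x / (x ^ 2 + (2 * Real.pi * (j + 1)) ^ 2)))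
      (1 / x - Real.exp (-(x / 2)) / (1 - Real.exp (-x))) := by
  have h2 := (hasSum_coth (half_pos hx)).mul_left (1 / 2)
  -- The odd-indexed terms at `x` are half the terms of the same series at `x / 2`.
  have hodd : HasSum (fun k : ℕ ↦ 2 * x / (x ^ 2 + (2 * Real.pi * ((2 * k + 1 : ℕ) + 1)) ^ 2))
      (1 / 2 * ((1 + Real.exp (-(x / 2))) / (2 * (1 - Real.exp (-(x / 2)))) - 1 / (x / 2))) := by
    convert! h2 using 1
    funext k
    push_cast
    have h3 : 0 < (x / 2) ^ 2 + (2 * Real.pi * (k + 1)) ^ 2 := by positivity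
    have h4 : 0 < x ^ 2 + (2 * Real.pi * (2 * k + 1 + 1)) ^ 2 := by positivity
    rw [mul_div_assoc', div_eq_div_iff h4.ne' h3.ne']
    ring
  convert! (hasSum_coth hx).alternating_of_odd hodd using 1
  have hq : Real.exp (-x) = Real.exp (-(x / 2)) ^ 2 := by
    rw [← Real.exp_nat_mul]; congr 1; push_cast; ring
  have hq1 : Real.exp (-(x / 2)) < 1 := by rw [Real.exp_lt_one_iff]; linarith
  have hq0 := Real.exp_pos (-(x / 2))
  rw [hq]
  generalize Real.exp (-(x / 2)) = q at hq0 hq1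
  have e1 : 1 - q ≠ 0 := by linarith
  have e2 : 1 + q ≠ 0 := by linarith
  have e3 : 1 - q ^ 2 = (1 - q) * (1 + q) := by ring
  rw [e3]
  field_simp
  ring

/-- The sine transform of `2 / (exp (2πt) + 1)` is `1/x - 1 / (2 sinh (x/2))`. -/
theorem integral_sin_div_exp_add_one {x : ℝ} (hx : 0 < x) :
    ∫ t in Ioi (0 : ℝ), 2 * Real.sin (x * t) / (Real.exp (2 * Real.pi * t) + 1) =
      1 / x - Real.exp (-(x / 2)) / (1 - Real.exp (-x)) := by
  have h := hasSum_integral_div_exp_add_one (f := fun t ↦ 2 * Real.sin (x * t)) (by fun_prop)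
    le_rfl (C := 2 * x) (fun t ht ↦ by
      rw [abs_mul, abs_two, pow_one, mul_assoc]
      refine mul_le_mul_of_nonneg_left ?_ two_pos.le
      exact (Real.abs_sin_le_abs).trans_eq (abs_of_pos (by positivity)))
  refine h.unique ?_
  convert! hasSum_csch hx using 1
  funext j
  simp only [mul_assoc (2 : ℝ)]
  rw [integral_const_mul]
  have := integral_sin_mul_exp_neg x (b := 2 * (Real.pi * (j + 1))) (by positivity)
  simp only [mul_assoc] at this ⊢
  rw [this]
  ring

theorem integrableOn_pow_div_exp_add_one (a : ℕ) :
    IntegrableOn (fun t : ℝ ↦ t ^ a / (Real.exp (2 * Real.pi * t) + 1)) (Ioi 0) := by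
  have hne (t : ℝ) : Real.exp (2 * Real.pi * t) + 1 ≠ 0 := by positivity
  refine Integrable.mono' (integrableOn_pow_mul_exp_neg a (b := 2 * Real.pi) (by positivity))
    (Continuous.aestronglyMeasurable (by fun_prop (disch := exact hne _))) ?_
  filter_upwards [ae_restrict_mem measurableSet_Ioi] with t ht
  have ht' : (0 : ℝ) < t := ht
  rw [Real.norm_of_nonneg (by positivity), Real.exp_neg, ← div_eq_mul_inv]
  gcongr
  linarith

/-! ### A Binet formula for harmonic numbers -/

/-- The integral `∫₀^∞ 2t / ((exp (2πt) + 1) (t² + N²)) dt`, which for `N > 0` represents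
`ψ(N + 1/2) - log N`, where `ψ` is the digamma function. -/
noncomputable def binetIntegral (N : ℝ) : ℝ :=
  ∫ t in Ioi (0 : ℝ), 2 * t / (Real.exp (2 * Real.pi * t) + 1) / (t ^ 2 + N ^ 2)

/-- Absolute integrability of the kernel whose two iterated integrals are `binetIntegral N` and its
Laplace representation. -/
theorem integrable_sin_kernel {N : ℝ} (hN : 0 < N) :
    Integrable (Function.uncurry fun x t : ℝ ↦
      Real.sin (x * t) * (Real.exp (-(N * x)) * (2 / (Real.exp (2 * Real.pi * t) + 1))))
      ((volume.restrict (Ioi 0)).prod (volume.restrict (Ioi 0))) := by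
  have h1 : Integrable (fun x : ℝ ↦ Real.exp (-(N * x))) (volume.restrict (Ioi 0)) := by
    simpa [IntegrableOn] using integrableOn_pow_mul_exp_neg 0 hN
  have h2 : Integrable (fun t : ℝ ↦ 2 / (Real.exp (2 * Real.pi * t) + 1))
      (volume.restrict (Ioi 0)) := by
    simpa [IntegrableOn, div_eq_mul_inv] using (integrableOn_pow_div_exp_add_one 0).const_mul 2
  refine (h1.mul_prod h2).bdd_mul (c := 1) (Continuous.aestronglyMeasurable (by fun_prop)) ?_
  exact Eventually.of_forall fun z ↦ Real.abs_sin_le_one _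

theorem integral_sin_kernel_inner {N x : ℝ} (hx : 0 < x) :
    ∫ t in Ioi (0 : ℝ),
      Real.sin (x * t) * (Real.exp (-(N * x)) * (2 / (Real.exp (2 * Real.pi * t) + 1))) =
    Real.exp (-(N * x)) * (1 / x - Real.exp (-(x / 2)) / (1 - Real.exp (-x))) := by
  rw [← integral_sin_div_exp_add_one hx, ← integral_const_mul]
  refine integral_congr_ae (Eventually.of_forall fun t ↦ ?_)
  simp only
  ring

theorem integrableOn_laplace {N : ℝ} (hN : 0 < N) : IntegrableOn (fun x : ℝ ↦
    Real.exp (-(N * x)) * (1 / x - Real.exp (-(x / 2)) / (1 - Real.exp (-x)))) (Ioi 0) := by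
  refine (integrable_sin_kernel hN).integral_prod_left.congr ?_
  filter_upwards [ae_restrict_mem measurableSet_Ioi] with x hx
  exact integral_sin_kernel_inner hx

theorem binetIntegral_eq_laplace {N : ℝ} (hN : 0 < N) :
    binetIntegral N = ∫ x in Ioi (0 : ℝ),
      Real.exp (-(N * x)) * (1 / x - Real.exp (-(x / 2)) / (1 - Real.exp (-x))) := by
  have h := integral_integral_swap (integrable_sin_kernel hN)
  rw [setIntegral_congr_fun measurableSet_Ioi fun x hx ↦ integral_sin_kernel_inner hx] at h
  rw [h, binetIntegral]
  refine integral_congr_ae (Eventually.of_forall fun t ↦ ?_)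
  simp only [← mul_assoc]
  rw [integral_mul_const]
  simp only [mul_comm _ t]
  rw [integral_sin_mul_exp_neg t hN]
  ring

/-- Multiplying the Laplace integrand by `1 - exp (-x)` clears the denominator: what remains is a
Frullani integrand and the exponential `exp (-(N + 1/2) x)`. -/
theorem binetIntegral_sub_add_one {N : ℝ} (hN : 0 < N) :
    binetIntegral N - binetIntegral (N + 1) = Real.log ((N + 1) / N) - 1 / (N + 1 / 2) := by
  have hN1 : 0 < N + 1 := by linarith
  have hN2 : 0 < N + 1 / 2 := by linarith
  have he : IntegrableOn (fun x : ℝ ↦ Real.exp (-((N + 1 / 2) * x))) (Ioi 0) := by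
    simpa using integrableOn_pow_mul_exp_neg 0 hN2
  have hd : IntegrableOn (fun x : ℝ ↦
      Real.exp (-(N * x)) * (1 / x - Real.exp (-(x / 2)) / (1 - Real.exp (-x))) -
        Real.exp (-((N + 1) * x)) * (1 / x - Real.exp (-(x / 2)) / (1 - Real.exp (-x))))
      (Ioi 0) := (integrableOn_laplace hN).sub (integrableOn_laplace hN1)
  have hkey : ∀ x ∈ Ioi (0 : ℝ),
      x⁻¹ • (Real.exp (-(N * x)) - Real.exp (-((N + 1) * x))) =
      (Real.exp (-(N * x)) * (1 / x - Real.exp (-(x / 2)) / (1 - Real.exp (-x))) -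
        Real.exp (-((N + 1) * x)) * (1 / x - Real.exp (-(x / 2)) / (1 - Real.exp (-x)))) +
        Real.exp (-((N + 1 / 2) * x)) := by
    intro x hx
    have h1 : Real.exp (-((N + 1) * x)) = Real.exp (-(N * x)) * Real.exp (-x) := by
      rw [← Real.exp_add]; congr 1; ring
    have h2 : Real.exp (-((N + 1 / 2) * x)) = Real.exp (-(N * x)) * Real.exp (-(x / 2)) := by
      rw [← Real.exp_add]; congr 1; ring
    have h3 : 1 - Real.exp (-x) ≠ 0 := by
      have : Real.exp (-x) < 1 := by rw [Real.exp_lt_one_iff]; exact neg_lt_zero.mpr hx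
      linarith
    have hx0 : x ≠ 0 := ne_of_gt hx
    rw [h1, h2, smul_eq_mul]
    field_simp
    ring
  have hF := Frullani.integral_Ioi_eq (f := fun x : ℝ ↦ Real.exp (-x)) (L := 1) (R := 0)
    ((show Continuous fun x : ℝ ↦ Real.exp (-x) by fun_prop).locallyIntegrable.locallyIntegrableOn
      _) hN hN1
    (by
      have : Tendsto (fun x : ℝ ↦ Real.exp (-x)) (𝓝 0) (𝓝 (Real.exp (-0))) :=
        Continuous.tendsto (by fun_prop) 0
      simpa using this.mono_left nhdsWithin_le_nhds)
    (by simpa using Real.tendsto_exp_neg_atTop_nhds_zero)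
    (((hd.add he).congr_fun (fun x hx ↦ (hkey x hx).symm) measurableSet_Ioi))
  rw [setIntegral_congr_fun measurableSet_Ioi hkey, integral_add hd he,
    integral_sub (integrableOn_laplace hN) (integrableOn_laplace hN1),
    ← binetIntegral_eq_laplace hN, ← binetIntegral_eq_laplace hN1] at hF
  have hI := integral_pow_mul_exp_neg 0 hN2
  simp only [pow_zero, one_mul, Nat.factorial_zero, Nat.cast_one, zero_add, pow_one] at hI
  rw [hI] at hF
  simp only [sub_zero, smul_eq_mul, mul_one] at hF
  linarith

theorem tendsto_binetIntegral : Tendsto binetIntegral atTop (𝓝 0) := by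
  have hI := (integrableOn_pow_div_exp_add_one 1).const_mul 2
  have hlim : Tendsto (fun N : ℝ ↦
      (∫ t in Ioi (0 : ℝ), 2 * (t ^ 1 / (Real.exp (2 * Real.pi * t) + 1))) / N ^ 2) atTop (𝓝 0) :=
    tendsto_const_nhds.div_atTop (tendsto_pow_atTop two_ne_zero)
  refine tendsto_of_tendsto_of_tendsto_of_le_of_le' tendsto_const_nhds hlim ?_ ?_
  · refine Eventually.of_forall fun N ↦ setIntegral_nonneg measurableSet_Ioi fun t ht ↦ ?_
    have : (0 : ℝ) < t := ht
    positivity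
  · filter_upwards [eventually_gt_atTop 0] with N hN
    rw [binetIntegral, ← integral_div]
    refine integral_mono_of_nonneg ?_ (hI.div_const _) ?_
    · filter_upwards [ae_restrict_mem measurableSet_Ioi] with t ht
      have : (0 : ℝ) < t := ht
      simp only [Pi.zero_apply]
      positivity
    · filter_upwards [ae_restrict_mem measurableSet_Ioi] with t ht
      have : (0 : ℝ) < t := ht
      rw [pow_one, ← mul_div_assoc]
      gcongr
      nlinarith

/-- Both sides have the same increments in `n`, and their difference tends to `0`. -/
theorem harmonic_eq_log_add_binetIntegral (n : ℕ) :
    (harmonic n : ℝ) = Real.log (n + 1 / 2) + Real.eulerMascheroniConstant +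
      binetIntegral (n + 1 / 2) := by
  set u : ℕ → ℝ := fun n ↦ harmonic n - Real.log (n + 1 / 2) - binetIntegral (n + 1 / 2) with hu
  have hstep (n : ℕ) : u (n + 1) = u n := by
    have hN : (0 : ℝ) < n + 1 / 2 := by positivity
    have h := binetIntegral_sub_add_one hN
    rw [Real.log_div (by positivity) hN.ne'] at h
    have e1 : (n : ℝ) + 1 / 2 + 1 / 2 = n + 1 := by ring
    have e2 : ((n + 1 : ℕ) : ℝ) + 1 / 2 = n + 1 / 2 + 1 := by push_cast; ring
    simp only [hu, harmonic_succ, e2]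
    rw [e1, one_div ((n : ℝ) + 1)] at h
    push_cast
    linarith
  have hconst (n : ℕ) : u n = u 0 := by
    induction n with
    | zero => rfl
    | succ n ih => rw [hstep, ih]
  have hlog : Tendsto (fun n : ℕ ↦ (harmonic n : ℝ) - Real.log (n + 1 / 2)) atTop
      (𝓝 Real.eulerMascheroniConstant) := by
    refine tendsto_of_tendsto_of_tendsto_of_le_of_le' Real.tendsto_harmonic_sub_log_add_one
      Real.tendsto_harmonic_sub_log ?_ ?_
    · filter_upwards with n
      have := Real.log_le_log (by positivity : (0 : ℝ) < n + 1 / 2)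
        (by linarith : (n : ℝ) + 1 / 2 ≤ n + 1)
      linarith
    · filter_upwards [eventually_gt_atTop 0] with n hn
      have := Real.log_le_log (by exact_mod_cast hn : (0 : ℝ) < n)
        (by linarith : (n : ℝ) ≤ n + 1 / 2)
      linarith
  have hB : Tendsto (fun n : ℕ ↦ binetIntegral (n + 1 / 2)) atTop (𝓝 0) :=
    tendsto_binetIntegral.comp
      (tendsto_atTop_add_const_right _ _ tendsto_natCast_atTop_atTop)
  have hlim : Tendsto u atTop (𝓝 Real.eulerMascheroniConstant) := by
    have := hlog.sub hB
    rwa [sub_zero] at this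
  have h0 : u 0 = Real.eulerMascheroniConstant :=
    tendsto_nhds_unique ((tendsto_const_nhds (x := u 0)).congr fun n ↦ (hconst n).symm) hlim
  have := (hconst n).trans h0
  simp only [hu] at this
  linarith

/-! ### Stieltjes transforms envelop their asymptotic expansion -/

theorem integral_pos_of_pos_on_Ioi {μ : Measure ℝ} (hpos : ∀ᵐ s ∂μ, 0 < s) (hμ : μ ≠ 0)
    {g : ℝ → ℝ} (hg : Integrable g μ) (h : ∀ s, 0 < s → 0 < g s) : 0 < ∫ s, g s ∂μ := by
  have h0 : 0 ≤ᵐ[μ] g := by filter_upwards [hpos] with s hs using (h s hs).le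
  rw [integral_pos_iff_support_of_nonneg_ae h0 hg, pos_iff_ne_zero]
  intro hsupp
  have hfalse : ∀ᵐ s ∂μ, False := by
    filter_upwards [hpos, measure_eq_zero_iff_ae_notMem.mp hsupp] with s hs hs'
    exact hs' (h s hs).ne'
  exact hμ (ae_eq_bot.mp (eventually_false_iff_eq_bot.mp hfalse))

/-- The expansion of the Stieltjes transform of a nonzero positive measure on `(0, ∞)` in powers of
`1/M`: the error is a fraction `Θ ∈ (0, 1)` of the first omitted term. -/
theorem exists_theta_stieltjes {μ : Measure ℝ} (hpos : ∀ᵐ s ∂μ, 0 < s) (hμ : μ ≠ 0)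
    (hint : ∀ k : ℕ, Integrable (fun s ↦ s ^ k) μ) {M : ℝ} (hM : 0 < M) (r : ℕ) :
    ∃ Θ : ℝ, 0 < Θ ∧ Θ < 1 ∧
      ∫ s, 1 / (M + s) ∂μ =
        ∑ p ∈ Finset.Icc 1 r, (-1) ^ (p - 1) * (∫ s, s ^ (p - 1) ∂μ) / M ^ p +
          Θ * ((-1) ^ r * (∫ s, s ^ r ∂μ) / M ^ (r + 1)) := by
  have hquot (k : ℕ) : Integrable (fun s ↦ s ^ k / (M + s)) μ := by
    refine Integrable.mono' ((hint k).div_const M)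
      (Measurable.aestronglyMeasurable (by fun_prop)) ?_
    filter_upwards [hpos] with s hs
    rw [Real.norm_of_nonneg (by positivity)]
    gcongr
    linarith
  -- Integrated form of `s^k / (M + s) = (s^k - s^(k+1) / (M + s)) / M`.
  have hrec (k : ℕ) : ∫ s, s ^ k / (M + s) ∂μ =
      ((∫ s, s ^ k ∂μ) - ∫ s, s ^ (k + 1) / (M + s) ∂μ) / M := by
    rw [← integral_sub (hint k) (hquot (k + 1)), ← integral_div]
    refine integral_congr_ae ?_
    filter_upwards [hpos] with s hs
    have : 0 < M + s := by linarith
    field_simp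
    ring
  have hexp (r : ℕ) : ∫ s, 1 / (M + s) ∂μ =
        ∑ p ∈ Finset.Icc 1 r, (-1) ^ (p - 1) * (∫ s, s ^ (p - 1) ∂μ) / M ^ p +
          (-1) ^ r * (∫ s, s ^ r / (M + s) ∂μ) / M ^ r := by
    induction r with
    | zero => simp
    | succ r ih =>
      rw [ih, Finset.sum_Icc_succ_top (by omega), hrec r, Nat.add_sub_cancel]
      field_simp
      ring
  have hr := integral_pos_of_pos_on_Ioi hpos hμ (hquot r) fun s hs ↦ by positivity
  have hr1 := integral_pos_of_pos_on_Ioi hpos hμ (hquot (r + 1)) fun s hs ↦ by positivity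
  have hm := integral_pos_of_pos_on_Ioi hpos hμ (hint r) fun s hs ↦ by positivity
  refine ⟨M * (∫ s, s ^ r / (M + s) ∂μ) / ∫ s, s ^ r ∂μ, by positivity, ?_, ?_⟩
  · rw [div_lt_one hm, hrec r]
    field_simp
    linarith
  · rw [hexp r]
    congr 1
    field_simp
    ring

/-! ### The measure representing the harmonic numbers -/

/-- The positive measure `μ` on `(0, ∞)` with `H_n - γ - ½ log M = ∫ dμ(s) / (M + s)` for
`M = n(n+1)`. It has density `1/2` on `(0, 1/4]` and `1 / (exp (2π √(s - 1/4)) + 1)` beyond `1/4`;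
the second part is encoded as the image of the measure `2t dt / (exp (2πt) + 1)` on `(0, ∞)` under
`t ↦ t² + 1/4`. -/
noncomputable def harmonicMeasure : Measure ℝ :=
  (1 / 2 : ENNReal) • volume.restrict (Ioc 0 (1 / 4)) +
    ((volume.restrict (Ioi (0 : ℝ))).withDensity fun t ↦
      ENNReal.ofReal (2 * t / (Real.exp (2 * Real.pi * t) + 1))).map fun t ↦ t ^ 2 + 1 / 4

theorem measurable_two_mul_div_exp_add_one :
    Measurable fun t : ℝ ↦ 2 * t / (Real.exp (2 * Real.pi * t) + 1) := by fun_prop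

theorem ae_harmonicMeasure_pos : ∀ᵐ s ∂harmonicMeasure, 0 < s := by
  rw [harmonicMeasure, ae_add_measure_iff]
  constructor
  · refine Measure.ae_smul_measure ?_ _
    filter_upwards [ae_restrict_mem measurableSet_Ioc] with s hs using hs.1
  · rw [ae_map_iff (by fun_prop) measurableSet_Ioi]
    exact Eventually.of_forall fun t ↦ by positivity

theorem harmonicMeasure_ne_zero : harmonicMeasure ≠ 0 := by
  intro h
  have := congrArg (fun μ ↦ μ (Ioc 0 (1 / 4))) h
  simp [harmonicMeasure] at this

/-- Integration against `harmonicMeasure`, in terms of integrals against Lebesgue measure. -/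
theorem integrable_and_integral_harmonicMeasure {g : ℝ → ℝ} (hg : Measurable g)
    (h1 : IntegrableOn g (Ioc 0 (1 / 4)))
    (h2 : IntegrableOn (fun t ↦ 2 * t / (Real.exp (2 * Real.pi * t) + 1) * g (t ^ 2 + 1 / 4))
      (Ioi 0)) :
    Integrable g harmonicMeasure ∧ ∫ s, g s ∂harmonicMeasure =
      1 / 2 * (∫ s in Ioc 0 (1 / 4), g s) +
        ∫ t in Ioi (0 : ℝ), 2 * t / (Real.exp (2 * Real.pi * t) + 1) * g (t ^ 2 + 1 / 4) := by
  have hpos : ∀ᵐ t ∂volume.restrict (Ioi (0 : ℝ)),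
      0 ≤ 2 * t / (Real.exp (2 * Real.pi * t) + 1) := by
    filter_upwards [ae_restrict_mem measurableSet_Ioi] with t ht
    have : (0 : ℝ) < t := ht
    positivity
  have i1 : Integrable g ((1 / 2 : ENNReal) • volume.restrict (Ioc 0 (1 / 4))) :=
    h1.smul_measure (by simp)
  have hmap : Measurable fun t : ℝ ↦ t ^ 2 + 1 / 4 := by fun_prop
  have i2 : Integrable g (((volume.restrict (Ioi (0 : ℝ))).withDensity fun t ↦
      ENNReal.ofReal (2 * t / (Real.exp (2 * Real.pi * t) + 1))).map fun t ↦ t ^ 2 + 1 / 4) := by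
    rw [integrable_map_measure hg.aestronglyMeasurable hmap.aemeasurable,
      integrable_withDensity_iff_integrable_smul'
        measurable_two_mul_div_exp_add_one.ennreal_ofReal (by simp)]
    refine h2.congr ?_
    filter_upwards [hpos] with t ht
    simp [ENNReal.toReal_ofReal ht]
  refine ⟨i1.add_measure i2, ?_⟩
  rw [harmonicMeasure, integral_add_measure i1 i2, integral_smul_measure,
    integral_map hmap.aemeasurable hg.aestronglyMeasurable,
    integral_withDensity_eq_integral_toReal_smul
      measurable_two_mul_div_exp_add_one.ennreal_ofReal (by simp)]
  congr 1
  · simp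
  · refine integral_congr_ae ?_
    filter_upwards [hpos] with t ht
    simp [ENNReal.toReal_ofReal ht]

/-- Binomial expansion of the integrand of the moments. Since `2 * (j + 1) - 1 = 2 * j + 1`, the
truncated subtraction is harmless; this form matches `integral_pow_div_exp_add_one`. -/
theorem density_mul_pow_eq_sum (k : ℕ) (t : ℝ) :
    2 * t / (Real.exp (2 * Real.pi * t) + 1) * (t ^ 2 + 1 / 4) ^ k =
      ∑ j ∈ Finset.range (k + 1), 2 * (1 / 4) ^ (k - j) * k.choose j *
        (t ^ (2 * (j + 1) - 1) / (Real.exp (2 * Real.pi * t) + 1)) := by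
  rw [add_pow, Finset.mul_sum]
  refine Finset.sum_congr rfl fun j _ ↦ ?_
  rw [show 2 * (j + 1) - 1 = 2 * j + 1 by omega, pow_succ t (2 * j), pow_mul t 2 j]
  ring

theorem integrableOn_density_mul_pow (k : ℕ) :
    IntegrableOn (fun t : ℝ ↦ 2 * t / (Real.exp (2 * Real.pi * t) + 1) * (t ^ 2 + 1 / 4) ^ k)
      (Ioi 0) := by
  simp only [density_mul_pow_eq_sum]
  exact integrable_finsetSum _ fun j _ ↦ (integrableOn_pow_div_exp_add_one _).const_mul _

theorem integrable_pow_harmonicMeasure (k : ℕ) :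
    Integrable (fun s ↦ s ^ k) harmonicMeasure :=
  (integrable_and_integral_harmonicMeasure (by fun_prop)
    ((continuous_pow k).integrableOn_Ioc) (integrableOn_density_mul_pow k)).1

/-- The moments of `harmonicMeasure` are, up to sign and a power of `2`, the coefficients of the
expansion: the part on `(0, 1/4]` gives the summand `1` inside `ramanujanCoeff`, the other part
the Bernoulli sum. -/
theorem integral_pow_harmonicMeasure {p : ℕ} (hp : 1 ≤ p) :
    (-1) ^ (p - 1) * ∫ s, s ^ (p - 1) ∂harmonicMeasure = 2 ^ p * ramanujanCoeff p := by
  obtain ⟨q, rfl⟩ : ∃ q, p = q + 1 := ⟨p - 1, by omega⟩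
  rw [Nat.add_sub_cancel,
    (integrable_and_integral_harmonicMeasure (g := fun s ↦ s ^ q) (by fun_prop)
      ((continuous_pow q).integrableOn_Ioc) (integrableOn_density_mul_pow q)).2]
  have h1 : ∫ s in Ioc (0 : ℝ) (1 / 4), s ^ q = (1 / 4) ^ (q + 1) / (q + 1) := by
    rw [← intervalIntegral.integral_of_le (by norm_num), integral_pow]
    simp
  simp only [density_mul_pow_eq_sum]
  rw [h1, integral_finsetSum _ fun j _ ↦ (integrableOn_pow_div_exp_add_one _).const_mul _]
  simp only [integral_const_mul]
  have hterm : ∀ j ∈ Finset.range (q + 1), 2 * (1 / 4 : ℝ) ^ (q - j) * q.choose j *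
        ∫ t in Ioi (0 : ℝ), t ^ (2 * (j + 1) - 1) / (Real.exp (2 * Real.pi * t) + 1) =
      (1 / 4) ^ (q + 1) / (2 * (q + 1)) * ((q + 1).choose (j + 1) * (-4) ^ (j + 1) *
        bernoulliFun (2 * (j + 1)) (1 / 2)) := by
    intro j hj
    have hjq : j ≤ q := by simpa [Nat.lt_succ_iff] using hj
    have hc : ((q : ℝ) + 1) * q.choose j = (q + 1).choose (j + 1) * (j + 1) := by
      exact_mod_cast Nat.add_one_mul_choose_eq q j
    have hp4 : (1 / 4 : ℝ) ^ (q - j) = (1 / 4) ^ (q + 1) * 4 ^ (j + 1) := by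
      rw [show q + 1 = (q - j) + (j + 1) by omega, pow_add, mul_assoc, ← mul_pow]
      norm_num
    have hc' : (q.choose j : ℝ) = (q + 1).choose (j + 1) * (j + 1) / (q + 1) := by
      rw [← hc]; field_simp
    rw [integral_pow_div_exp_add_one (by omega), hp4, hc', neg_pow (4 : ℝ)]
    push_cast
    field_simp
    ring
  have hIcc : Finset.Icc 1 (q + 1) = Finset.Ico (0 + 1) (q + 1 + 1) := by
    ext; simp only [Finset.mem_Icc, Finset.mem_Ico]; omega
  rw [Finset.sum_congr rfl hterm, ← Finset.mul_sum, ramanujanCoeff, Nat.add_sub_cancel, hIcc,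
    ← Finset.sum_Ico_add', Finset.range_eq_Ico]
  have h8 : (8 : ℝ) ^ (q + 1) = 2 ^ (q + 1) * 4 ^ (q + 1) := by rw [← mul_pow]; norm_num
  rw [h8, one_div_pow]
  push_cast
  field_simp

theorem integral_inv_add_harmonicMeasure {M : ℝ} (hM : 0 < M) :
    ∫ s, 1 / (M + s) ∂harmonicMeasure =
      1 / 2 * Real.log ((M + 1 / 4) / M) + binetIntegral (Real.sqrt (M + 1 / 4)) := by
  have hc : ContinuousOn (fun s : ℝ ↦ 1 / (M + s)) (Icc 0 (1 / 4)) := by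
    refine ContinuousOn.div (by fun_prop) (by fun_prop) fun s hs ↦ ?_
    have := hs.1
    positivity
  have h2 : IntegrableOn (fun t : ℝ ↦ 2 * t / (Real.exp (2 * Real.pi * t) + 1) *
      (1 / (M + (t ^ 2 + 1 / 4)))) (Ioi 0) := by
    refine Integrable.mono' ((integrableOn_density_mul_pow 0).div_const M)
      (Measurable.aestronglyMeasurable (by fun_prop)) ?_
    filter_upwards [ae_restrict_mem measurableSet_Ioi] with t ht
    have : (0 : ℝ) < t := ht
    rw [Real.norm_of_nonneg (by positivity), pow_zero, mul_one, mul_one_div]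
    gcongr
    nlinarith
  rw [(integrable_and_integral_harmonicMeasure (by fun_prop)
    (hc.integrableOn_Icc.mono_set Ioc_subset_Icc_self)
    h2).2]
  congr 1
  · congr 1
    rw [← intervalIntegral.integral_of_le (by norm_num),
      intervalIntegral.integral_comp_add_left (fun s ↦ 1 / s), add_zero,
      integral_one_div_of_pos hM (by positivity)]
  · rw [binetIntegral]
    refine integral_congr_ae (Eventually.of_forall fun t ↦ ?_)
    simp only
    rw [Real.sq_sqrt (by positivity), mul_one_div]
    congr 1
    ring

theorem harmonic_eq_log_add_integral_harmonicMeasure {n : ℕ} (hn : 1 ≤ n) :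
    (harmonic n : ℝ) = 1 / 2 * Real.log (n * (n + 1)) + Real.eulerMascheroniConstant +
      ∫ s, 1 / ((n : ℝ) * (n + 1) + s) ∂harmonicMeasure := by
  have hn0 : (0 : ℝ) < n := by exact_mod_cast hn
  have hM : (0 : ℝ) < n * (n + 1) := by positivity
  have hN : (0 : ℝ) < n + 1 / 2 := by positivity
  have hsq : (n : ℝ) * (n + 1) + 1 / 4 = (n + 1 / 2) ^ 2 := by ring
  rw [integral_inv_add_harmonicMeasure hM, hsq, Real.sqrt_sq hN.le,
    Real.log_div (by positivity) hM.ne', Real.log_pow, harmonic_eq_log_add_binetIntegral]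
  push_cast
  ring

/-! ### The enveloping expansion of the harmonic numbers -/

theorem theorem1 (n r : ℕ) (hn : 1 ≤ n) (hr : 1 ≤ r)
    (m : ℝ) (hm : m = (n : ℝ) * ((n : ℝ) + 1) / 2) :
    (∃ Θ : ℝ, 0 < Θ ∧ Θ < 1 ∧
      ∑ k ∈ Finset.Icc 1 n, 1 / (k : ℝ) =
        1 / 2 * Real.log (2 * m) + Real.eulerMascheroniConstant
          + ∑ p ∈ Finset.Icc 1 r, ramanujanCoeff p / m ^ p
          + Θ * (ramanujanCoeff (r + 1) / m ^ (r + 1))) ∧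
    |∑ k ∈ Finset.Icc 1 n, 1 / (k : ℝ) -
        (1 / 2 * Real.log (2 * m) + Real.eulerMascheroniConstant
          + ∑ p ∈ Finset.Icc 1 r, ramanujanCoeff p / m ^ p)| <
      |ramanujanCoeff (r + 1) / m ^ (r + 1)| := by
  have hM : (0 : ℝ) < n * (n + 1) := by
    have : (0 : ℝ) < n := by exact_mod_cast hn
    positivity
  have h2m : (n : ℝ) * (n + 1) = 2 * m := by rw [hm]; ring
  have hm0 : 0 < m := by rw [hm]; positivity
  obtain ⟨Θ, hΘ0, hΘ1, hΘ⟩ := exists_theta_stieltjes ae_harmonicMeasure_pos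
    harmonicMeasure_ne_zero integrable_pow_harmonicMeasure hM r
  have hcoeff {p : ℕ} (hp : 1 ≤ p) :
      (-1) ^ (p - 1) * (∫ s, s ^ (p - 1) ∂harmonicMeasure) / ((n : ℝ) * (n + 1)) ^ p =
        ramanujanCoeff p / m ^ p := by
    rw [integral_pow_harmonicMeasure hp, h2m, mul_pow]
    exact mul_div_mul_left _ _ (by positivity)
  have hlast := hcoeff (p := r + 1) (by omega)
  rw [Nat.add_sub_cancel] at hlast
  rw [Finset.sum_congr rfl fun p hp ↦ hcoeff (Finset.mem_Icc.mp hp).1, hlast] at hΘ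
  have hH : ∑ k ∈ Finset.Icc 1 n, 1 / (k : ℝ) = harmonic n := by
    rw [harmonic_eq_sum_Icc]; push_cast; simp
  have hmain : ∑ k ∈ Finset.Icc 1 n, 1 / (k : ℝ) =
        1 / 2 * Real.log (2 * m) + Real.eulerMascheroniConstant
          + ∑ p ∈ Finset.Icc 1 r, ramanujanCoeff p / m ^ p
          + Θ * (ramanujanCoeff (r + 1) / m ^ (r + 1)) := by
    rw [hH, harmonic_eq_log_add_integral_harmonicMeasure hn, hΘ, h2m]
    ring
  refine ⟨⟨Θ, hΘ0, hΘ1, hmain⟩, ?_⟩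
  have hne : ramanujanCoeff (r + 1) ≠ 0 := by
    intro h0
    have hmom := integral_pow_harmonicMeasure (p := r + 1) (by omega)
    rw [h0, mul_zero, Nat.add_sub_cancel] at hmom
    have := integral_pos_of_pos_on_Ioi ae_harmonicMeasure_pos harmonicMeasure_ne_zero
      (integrable_pow_harmonicMeasure r) fun s hs ↦ by positivity
    exact (mul_ne_zero (by positivity) this.ne') hmom
  rw [hmain, add_sub_cancel_left, abs_mul, abs_of_pos hΘ0]
  have : 0 < |ramanujanCoeff (r + 1) / m ^ (r + 1)| := abs_pos.mpr (by positivity)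
  nlinarith
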